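/- **Setting.** A continuous-time control system with outputs consists of normed spaces $X$ (states), $Y$ (outputs) and $\mathcal U$ (inputs, a shift- and restriction-invariant linear space of functions $[0,\infty)\to U$, shifts and restrictions not increasing the norm), a transition map $\phi$ defined for $t\in[0,t_m(x,u))$, $t_m(x,u)\in(0,\infty]$, satisfying the identity, causality and cocycle properties, and an output map $h\colon X\times U\to Y$; put $y(t,x,u)=h(\phi(t,x,u),u(t))$. It is - *forward complete (FC)* if $t_m(x,u)=\infty$ for all $x,u$; - *0-UGATT* if for all $\varepsilon,\delta>0$ there is $T\ge 0$ with $\|\phi(t,x,0)\|\le\varepsilon$ whenever $\|x\|\le\delta$, $t\ge T$; - *0-UAS* if there are $r>0$ and $\beta\in\mathcal{KL}$ with $\|\phi(t,x,0)\|\le\beta(\|x\|,t)$ for all $\|x\|<r$, $t\ge0$; - *BORS* (bounded output reachability sets) if $\sup_{\|x\|<C,\ \|u\|<C,\ t<\tau}\|y(t,x,u)\|<\infty$ for all $C>0$, $\tau\ge0$; - *OUAG* if there is $\gamma\in\mathcal K_\infty$ such that for all $\varepsilon,r,s>0$ there is $\tau\ge0$ with $\|y(t,x,u)\|\le\varepsilon+\gamma(\|u\|)$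 for all $\|x\|<r$, $\|u\|<s$, $t\ge\tau$; - *OCAG* if there are $\beta\in\mathcal{KL}$, $\gamma\in\mathcal K_\infty$, $c\ge0$ with $\|y(t,x,u)\|\le\beta(\|x\|+c,t)+\gamma(\|u\|)$ for all $x,u$ and $t\ge0$. Here $\mathcal K$ is the class of continuous strictly increasing functions $[0,\infty)\to[0,\infty)$ vanishing at $0$, $\mathcal K_\infty$ the unbounded ones among them, and $\beta\in\mathcal{KL}$ means that $\beta(\cdot,t)\in\mathcal K$ for all $t\ge0$ and that $\beta(r,\cdot)$ is continuous and decreasing with limit $0$ at infinity for all $r>0$. **Statement.** On $X=Y=\ell^2(\mathbb N_0,\mathbb R)$ with $U=\mathcal U=\{0\}$, consider the system $$\dot x_0=-x_0,\qquad \dot x_n=-x_n+x_n^2x_0-x_n|x_n|-\tfrac1{n^2}x_n^3\quad(n\ge1),\qquad y=x .$$ Its right-hand side $F$ maps $X$ to $X$ and is Lipschitz continuous on bounded balls. For every $x\in X$ there is a unique maximal mild solution, i.e. a unique maximal continuous $t\mapsto\phi(t,x)\in X$ with $\phi(t,x)=x+\int_0^tF(\phi(s,x))\,ds$, and $\phi$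 together with $h(x,u)=x$ forms a control system with outputs $\Sigma$. This $\Sigma$ is forward complete, 0-UGATT and 0-UAS; moreover, for every $r<1$ there is $\beta\in\mathcal{KL}$ such that $\|\phi(t,x)\|\le\beta(\|x\|,t)$ for all $t\ge0$ and all $x\in X$ with $|x_n|\le r$ for every $n\in\mathbb N_0$. However, $\Sigma$ is not BORS. Consequently, BORS cannot be dropped in the equivalence "OUAG and BORS $\iff$ OCAG": $\Sigma$ is OUAG but not OCAG. -/

import Mathlib

open scoped NNReal ENNReal

/-! ### Comparison functions -/

/-- Class `𝒦`: continuous, strictly increasing, vanishing at zero. -/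
structure IsClassK (γ : ℝ≥0 → ℝ≥0) : Prop where
  map_zero : γ 0 = 0
  continuous : Continuous γ
  strictMono : StrictMono γ

/-- Class `𝒦∞`: unbounded functions of class `𝒦`. -/
structure IsClassKInfty (γ : ℝ≥0 → ℝ≥0) : Prop where
  isClassK : IsClassK γ
  unbounded : ∀ M : ℝ≥0, ∃ r : ℝ≥0, M < γ r

/-- Class `ℒ`: continuous, decreasing, tending to zero at infinity. -/
structure IsClassL (γ : ℝ≥0 → ℝ≥0) : Prop where
  continuous : Continuous γ
  antitone : Antitone γ
  tendsto_zero : Filter.Tendsto γ Filter.atTop (nhds 0)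

/-- Class `𝒦ℒ`: `β(·,t) ∈ 𝒦` for all `t ≥ 0` and `β(r,·) ∈ ℒ` for all `r > 0`. -/
structure IsClassKL (β : ℝ≥0 → ℝ≥0 → ℝ≥0) : Prop where
  isClassK : ∀ t : ℝ≥0, IsClassK (fun r => β r t)
  isClassL : ∀ r : ℝ≥0, 0 < r → IsClassL (β r)

/-! ### Continuous-time control systems with outputs -/

/-- The data of a control system with outputs over the time set `ℝ≥0`: `X` is the state space, `U`
the space of input values, `𝒰` the normed space of inputs, regarded as functions of time through
`input`, and `Y` the output-value space. The transition map `phi t x u` is meaningful exactly for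
`t ∈ [0, tmax x u)`; its values for other `t` are irrelevant. The output map is `h`. -/
structure OutputSystem (X U 𝒰 Y : Type*)
    [NormedAddCommGroup X] [NormedSpace ℝ X] [AddCommGroup U] [Module ℝ U]
    [NormedAddCommGroup 𝒰] [NormedSpace ℝ 𝒰] [NormedAddCommGroup Y] [NormedSpace ℝ Y] where
  input : 𝒰 →ₗ[ℝ] (ℝ≥0 → U)
  tmax : X → 𝒰 → ℝ≥0∞
  phi : ℝ≥0 → X → 𝒰 → X
  h : X → U → Y

namespace OutputSystem

variable {X U 𝒰 Y : Type*}
    [NormedAddCommGroup X] [NormedSpace ℝ X] [AddCommGroup U] [Module ℝ U]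
    [NormedAddCommGroup 𝒰] [NormedSpace ℝ 𝒰] [NormedAddCommGroup Y] [NormedSpace ℝ Y]

/-- The axioms of a control system: inputs are a linear subspace of the functions of time that is
invariant under shifts and restrictions (neither of which increases the norm), trajectories live on
nondegenerate intervals, and the identity, causality and cocycle properties hold. -/
structure IsControlSystem (S : OutputSystem X U 𝒰 Y) : Prop where
  input_injective : Function.Injective S.input
  shift_invariance : ∀ (u : 𝒰) (τ : ℝ≥0),
    ∃ v : 𝒰, (∀ t, S.input v t = S.input u (t + τ)) ∧ ‖v‖ ≤ ‖u‖
  restriction_invariance : ∀ (u : 𝒰) (t₁ t₂ : ℝ≥0), t₁ ≤ t₂ →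
    ∃ v : 𝒰, S.input v = Set.indicator (Set.Icc t₁ t₂) (S.input u) ∧ ‖v‖ ≤ ‖u‖
  tmax_pos : ∀ (x : X) (u : 𝒰), 0 < S.tmax x u
  identity : ∀ (x : X) (u : 𝒰), S.phi 0 x u = x
  causality : ∀ (t : ℝ≥0) (x : X) (u v : 𝒰), (t : ℝ≥0∞) < S.tmax x u →
    (∀ s ≤ t, S.input u s = S.input v s) →
    (t : ℝ≥0∞) < S.tmax x v ∧ S.phi t x u = S.phi t x v
  cocycle : ∀ (x : X) (u v : 𝒰) (t s : ℝ≥0), ((t + s : ℝ≥0) : ℝ≥0∞) < S.tmax x u →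
    (∀ r, S.input v r = S.input u (t + r)) →
    (s : ℝ≥0∞) < S.tmax (S.phi t x u) v ∧ S.phi (t + s) x u = S.phi s (S.phi t x u) v

/-- The output `y(t,x,u) = h(φ(t,x,u), u(t))`. -/
def y (S : OutputSystem X U 𝒰 Y) (t : ℝ≥0) (x : X) (u : 𝒰) : Y :=
  S.h (S.phi t x u) (S.input u t)

/-- Forward completeness (FC). -/
def ForwardComplete (S : OutputSystem X U 𝒰 Y) : Prop :=
  ∀ (x : X) (u : 𝒰) (t : ℝ≥0), (t : ℝ≥0∞) < S.tmax x u

/-- Uniform global attractivity at zero (0-UGATT). -/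
def ZeroUGATT (S : OutputSystem X U 𝒰 Y) : Prop :=
  ∀ ε : ℝ, 0 < ε → ∀ δ : ℝ, 0 < δ → ∃ T : ℝ≥0,
    ∀ x : X, ‖x‖ ≤ δ → ∀ t : ℝ≥0, T ≤ t → ‖S.phi t x 0‖ ≤ ε

/-- A `𝒦ℒ` estimate for the trajectories with zero input that start in the set `A`. -/
def ZeroKLEstimateOn (S : OutputSystem X U 𝒰 Y) (A : Set X) : Prop :=
  ∃ β : ℝ≥0 → ℝ≥0 → ℝ≥0, IsClassKL β ∧
    ∀ x ∈ A, ∀ t : ℝ≥0, ‖S.phi t x 0‖₊ ≤ β ‖x‖₊ t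

/-- Uniform asymptotic stability at zero (0-UAS). -/
def ZeroUAS (S : OutputSystem X U 𝒰 Y) : Prop :=
  ∃ r : ℝ, 0 < r ∧ S.ZeroKLEstimateOn (Metric.ball 0 r)

/-- Bounded output reachability sets (BORS). -/
def BORS (S : OutputSystem X U 𝒰 Y) : Prop :=
  ∀ C : ℝ, 0 < C → ∀ τ : ℝ≥0, ∃ M : ℝ,
    ∀ (x : X) (u : 𝒰) (t : ℝ≥0), ‖x‖ < C → ‖u‖ < C → t < τ → ‖S.y t x u‖ ≤ M

/-- Output-uniform asymptotic gain property (OUAG). -/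
def OUAG (S : OutputSystem X U 𝒰 Y) : Prop :=
  ∃ γ : ℝ≥0 → ℝ≥0, IsClassKInfty γ ∧
    ∀ ε r s : ℝ≥0, 0 < ε → 0 < r → 0 < s → ∃ τ : ℝ≥0,
      ∀ (x : X) (u : 𝒰) (t : ℝ≥0), ‖x‖₊ < r → ‖u‖₊ < s → τ ≤ t →
        ‖S.y t x u‖₊ ≤ ε + γ ‖u‖₊

/-- Output-complete asymptotic gain property (OCAG). -/
def OCAG (S : OutputSystem X U 𝒰 Y) : Prop :=
  ∃ (β : ℝ≥0 → ℝ≥0 → ℝ≥0) (γ : ℝ≥0 → ℝ≥0) (c : ℝ≥0), IsClassKL β ∧ IsClassKInfty γ ∧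
    ∀ (x : X) (u : 𝒰) (t : ℝ≥0), ‖S.y t x u‖₊ ≤ β (‖x‖₊ + c) t + γ ‖u‖₊

end OutputSystem

/-! ### Mild solutions of `ẋ = F(x)` and the uncontrolled system they generate -/

section Mild

variable {X : Type*} [NormedAddCommGroup X] [NormedSpace ℝ X]

/-- `ξ` is a mild solution of `ẋ = F(x)`, `x(0) = x₀`, on `[0, T)`, where `T ∈ [0, ∞]`: it is
continuous and satisfies `ξ(t) = x₀ + ∫₀ᵗ F(ξ(s)) ds` there. -/
def IsMildSolution (F : X → X) (x₀ : X) (T : ℝ≥0∞) (ξ : ℝ≥0 → X) : Prop :=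
  ContinuousOn ξ {t : ℝ≥0 | (t : ℝ≥0∞) < T} ∧
    ∀ t : ℝ≥0, (t : ℝ≥0∞) < T → ξ t = x₀ + ∫ s in (0 : ℝ)..(t : ℝ), F (ξ s.toNNReal)

/-- `ξ` on `[0, T)`, `T > 0`, is the unique maximal mild solution: it is a mild solution, and every
mild solution with the same initial value is a restriction of it. -/
def IsUniqueMaximalMildSolution (F : X → X) (x₀ : X) (T : ℝ≥0∞) (ξ : ℝ≥0 → X) : Prop :=
  0 < T ∧ IsMildSolution F x₀ T ξ ∧
    ∀ (T' : ℝ≥0∞) (ξ' : ℝ≥0 → X), IsMildSolution F x₀ T' ξ' →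
      T' ≤ T ∧ ∀ t : ℝ≥0, (t : ℝ≥0∞) < T' → ξ' t = ξ t

open Classical in
/-- The uncontrolled system with full-state output generated by `ẋ = F(x)`: input values and inputs
are trivial, `tmax` is the supremum of the existence times of mild solutions, `phi t x` is the value
at `t` of a mild solution from `x` that exists beyond `t`, and `y = φ`. -/
noncomputable def mildSystem (F : X → X) : OutputSystem X Unit Unit X where
  input := 0
  tmax x _ := sSup {T : ℝ≥0∞ | ∃ ξ : ℝ≥0 → X, IsMildSolution F x T ξ}
  phi t x _ :=
    if H : ∃ ξ : ℝ≥0 → X, ∃ T : ℝ≥0∞, (t : ℝ≥0∞) < T ∧ IsMildSolution F x T ξ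
    then H.choose t else 0
  h x _ := x

end Mild

/-! ### The system on `ℓ²` -/

/-- The Hilbert space `ℓ²(ℕ₀, ℝ)`. -/
abbrev EllTwo : Type := lp (fun _ : ℕ => ℝ) 2

/-- The components of the right-hand side: `-x₀` for `n = 0`, and
`-xₙ + xₙ² x₀ - xₙ |xₙ| - xₙ³ / n²` for `n ≥ 1`. -/
noncomputable def exampleRhs (x : ℕ → ℝ) (n : ℕ) : ℝ :=
  if n = 0 then -x 0
  else -x n + x n ^ 2 * x 0 - x n * |x n| - 1 / (n : ℝ) ^ 2 * x n ^ 3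

theorem memℓp_exampleRhs (x : EllTwo) : Memℓp (exampleRhs x) 2 := by
  have hb : ∀ n, |x n| ≤ ‖x‖ := fun n => by
    simpa using lp.norm_apply_le_norm (by norm_num) x n
  have hN : 0 ≤ ‖x‖ := norm_nonneg x
  have key : ∀ n, |exampleRhs x n| ≤ (1 + 2 * ‖x‖ ^ 2 + ‖x‖) * |x n| := by
    intro n
    have ha : 0 ≤ |x n| := abs_nonneg _
    by_cases hn : n = 0
    · subst hn
      simp only [exampleRhs, if_true, abs_neg]
      nlinarith [sq_nonneg ‖x‖]
    · have hn1 : (1 : ℝ) ≤ (n : ℝ) ^ 2 := by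
        have : (1 : ℝ) ≤ n := by exact_mod_cast Nat.one_le_iff_ne_zero.mpr hn
        nlinarith
      have h1 : 1 / (n : ℝ) ^ 2 ≤ 1 := by
        rw [div_le_one (by linarith)]; exact hn1
      have h0 : 0 ≤ 1 / (n : ℝ) ^ 2 := by positivity
      simp only [exampleRhs, if_neg hn]
      have t1 : |x n ^ 2 * x 0| ≤ ‖x‖ ^ 2 * |x n| := by
        rw [abs_mul, abs_pow]
        have := mul_le_mul (hb n) (hb 0) (abs_nonneg _) hN
        nlinarith
      have t2 : |x n * (|x n|)| ≤ ‖x‖ * |x n| := by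
        rw [abs_mul, abs_abs]
        nlinarith [hb n]
      have t3 : |1 / (n : ℝ) ^ 2 * x n ^ 3| ≤ ‖x‖ ^ 2 * |x n| := by
        rw [abs_mul, abs_pow, abs_of_nonneg h0]
        have h2 : |x n| ^ 2 ≤ ‖x‖ ^ 2 := by gcongr; exact hb n
        have h3 : |x n| ^ 3 ≤ ‖x‖ ^ 2 * |x n| := by nlinarith
        have h4 : 0 ≤ |x n| ^ 3 := by positivity
        nlinarith
      have e1 := abs_sub (-x n + x n ^ 2 * x 0 - x n * |x n|) (1 / (n : ℝ) ^ 2 * x n ^ 3)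
      have e2 := abs_sub (-x n + x n ^ 2 * x 0) (x n * |x n|)
      have e3 := abs_add_le (-x n) (x n ^ 2 * x 0)
      rw [abs_neg] at e3
      linarith
  have hx : Memℓp (fun n => (1 + 2 * ‖x‖ ^ 2 + ‖x‖) * x n) 2 := (lp.memℓp x).const_mul _
  refine hx.mono' ?_
  intro n
  have hk : 0 ≤ 1 + 2 * ‖x‖ ^ 2 + ‖x‖ := by positivity
  rw [Real.norm_eq_abs, Real.norm_eq_abs, abs_mul, abs_of_nonneg hk]
  exact key n

/-- The right-hand side as a vector field on `ℓ²`. -/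
noncomputable def exampleField (x : EllTwo) : EllTwo :=
  ⟨exampleRhs x, memℓp_exampleRhs x⟩

/-- The system on `ℓ²`, without inputs and with full-state output. -/
noncomputable def exampleSystem : OutputSystem EllTwo Unit Unit EllTwo :=
  mildSystem exampleField

/-! The coordinate `x₀` decays like `e^{-t}` and is the only coupling. For `n ≥ 1` half the rate of
`xₙ²` is at most `xₙ²(-1 + |xₙ||x₀| - |xₙ| - xₙ²/n²)`, so with `|x₀| ≤ D` a mode can grow only while
`1/D < |xₙ| < n²D`. A square-summable initial state has finitely many modes that are not small, and
each of these is trapped below a finite barrier; hence trajectories stay bounded and exist for all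
time.

Once `|x₀| ≤ 1/2`, the term `-xₙ|xₙ|` forces `|xₙ| ≤ 2/t` after a further time `t`, whatever size
the mode had reached. This erases the transient uniformly on bounded sets (`sq_mul_sq_apply_le`),
and since `|x₀| ≤ 1` gives decay like `e^{-t}` (`norm_le_exp`), uniform attractivity follows.

The transient itself is not uniform: the cubic damping of mode `n` is felt only at height about
`n²`, so from `x₀ = 12`, `xₙ = 1` the mode follows a Riccati blow-up past `n²` before time 1
(`exists_natCast_sq_lt`). Thus BORS fails, and with it OCAG, which implies BORS. -/

/-! ### Mild solutions: uniqueness and the generated semiflow -/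

section MildTheory

variable {X : Type*} [NormedAddCommGroup X] [NormedSpace ℝ X]

theorem IsMildSolution.continuous_comp_min_toNNReal {F : X → X} {x : X} {T : ℝ≥0∞} {ξ : ℝ≥0 → X}
    (h : IsMildSolution F x T ξ) {b : ℝ} (hb : (b.toNNReal : ℝ≥0∞) < T) :
    Continuous (fun s : ℝ => ξ (min s b).toNNReal) := by
  refine h.1.comp_continuous
    (continuous_real_toNNReal.comp (continuous_id.min continuous_const)) fun s => ?_
  refine lt_of_le_of_lt ?_ hb
  exact_mod_cast Real.toNNReal_le_toNNReal (min_le_right s b)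

theorem IsMildSolution.apply_zero {F : X → X} {x : X} {T : ℝ≥0∞} {ξ : ℝ≥0 → X}
    (h : IsMildSolution F x T ξ) (hT : 0 < T) : ξ 0 = x := by
  simpa using h.2 0 (by simpa using hT)

theorem IsMildSolution.hasDerivWithinAt [CompleteSpace X] {F : X → X} (hF : Continuous F) {x : X} {T : ℝ≥0∞}
    {ξ : ℝ≥0 → X} (h : IsMildSolution F x T ξ) {t : ℝ} (ht : 0 ≤ t)
    (htT : (t.toNNReal : ℝ≥0∞) < T) :
    HasDerivWithinAt (fun s : ℝ => ξ s.toNNReal) (F (ξ t.toNNReal)) (Set.Ici t) t := by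
  obtain ⟨b, hb₁, hb₂⟩ := ENNReal.lt_iff_exists_nnreal_btwn.1 htT
  have htb : t < b := by
    have : t.toNNReal < b := by exact_mod_cast hb₁
    exact (Real.toNNReal_lt_iff_lt_coe ht).1 this
  -- Freezing time at `b` makes the integrand continuous on all of `ℝ`, so the fundamental theorem
  -- of calculus applies at `t`.
  have hc : Continuous (fun s : ℝ => F (ξ (min s b).toNNReal)) :=
    hF.comp (h.continuous_comp_min_toNNReal (b := b) (by simpa using hb₂))
  have hd : HasDerivAt (fun u : ℝ => x + ∫ s in (0 : ℝ)..u, F (ξ (min s b).toNNReal))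
      (F (ξ (min t b).toNNReal)) t :=
    (intervalIntegral.integral_hasDerivAt_right (hc.intervalIntegrable _ _)
      hc.aestronglyMeasurable.stronglyMeasurableAtFilter hc.continuousAt).const_add x
  rw [min_eq_left htb.le] at hd
  have key : ∀ u : ℝ, 0 ≤ u → u < b →
      ξ u.toNNReal = x + ∫ s in (0 : ℝ)..u, F (ξ (min s b).toNNReal) := by
    intro u hu hub
    rw [h.2 u.toNNReal (lt_of_le_of_lt (by exact_mod_cast Real.toNNReal_le_iff_le_coe.2 hub.le) hb₂),
      Real.coe_toNNReal u hu]
    congr 1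
    refine intervalIntegral.integral_congr fun s hs => ?_
    rw [Set.uIcc_of_le hu] at hs
    simp only [min_eq_left (hs.2.trans hub.le)]
  refine hd.hasDerivWithinAt.congr_of_eventuallyEq ?_ (key t ht htb)
  filter_upwards [Ico_mem_nhdsGE htb] with u hu using key u (ht.trans hu.1) hu.2

theorem IsMildSolution.eq_of_lt [CompleteSpace X] {F : X → X}
    (hF : ∀ R : ℝ, ∃ K : ℝ≥0, LipschitzOnWith K F (Metric.closedBall 0 R)) (hFc : Continuous F)
    {x : X} {T T' : ℝ≥0∞} {ξ ξ' : ℝ≥0 → X} (h : IsMildSolution F x T ξ)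
    (h' : IsMildSolution F x T' ξ') {t : ℝ≥0} (ht : (t : ℝ≥0∞) < T) (ht' : (t : ℝ≥0∞) < T') :
    ξ t = ξ' t := by
  have ht₀ : ((t : ℝ).toNNReal : ℝ≥0∞) < T := by simpa using ht
  have ht₀' : ((t : ℝ).toNNReal : ℝ≥0∞) < T' := by simpa using ht'
  have c := (h.continuous_comp_min_toNNReal ht₀).continuousOn (s := Set.Icc 0 (t : ℝ))
  have c' := (h'.continuous_comp_min_toNNReal ht₀').continuousOn (s := Set.Icc 0 (t : ℝ))
  have c₁ : ContinuousOn (fun s : ℝ => ξ s.toNNReal) (Set.Icc 0 t) :=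
    c.congr fun s hs => by simp only [min_eq_left hs.2]
  have c₁' : ContinuousOn (fun s : ℝ => ξ' s.toNNReal) (Set.Icc 0 t) :=
    c'.congr fun s hs => by simp only [min_eq_left hs.2]
  -- Both curves are bounded on the compact interval, so a single Lipschitz constant serves for ODE
  -- uniqueness.
  obtain ⟨R, hR⟩ := (isCompact_Icc.image_of_continuousOn c₁).isBounded.subset_closedBall 0
  obtain ⟨R', hR'⟩ := (isCompact_Icc.image_of_continuousOn c₁').isBounded.subset_closedBall 0
  obtain ⟨K, hK⟩ := hF (max R R')
  have lt_of : ∀ s ∈ Set.Ico (0 : ℝ) t, ∀ S : ℝ≥0∞, (t : ℝ≥0∞) < S → (s.toNNReal : ℝ≥0∞) < S :=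
    fun s hs S hS => lt_of_le_of_lt
      (by exact_mod_cast Real.toNNReal_le_iff_le_coe.2 hs.2.le) hS
  have := ODE_solution_unique_of_mem_Icc_right (v := fun _ => F)
    (s := fun _ => Metric.closedBall 0 (max R R')) (fun _ _ => hK) c₁
    (fun s hs => h.hasDerivWithinAt hFc hs.1 (lt_of s hs T ht))
    (fun s hs => Metric.closedBall_subset_closedBall (le_max_left _ _)
      (hR ⟨s, ⟨hs.1, hs.2.le⟩, rfl⟩)) c₁'
    (fun s hs => h'.hasDerivWithinAt hFc hs.1 (lt_of s hs T' ht'))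
    (fun s hs => Metric.closedBall_subset_closedBall (le_max_right _ _)
      (hR' ⟨s, ⟨hs.1, hs.2.le⟩, rfl⟩))
    (by simp [h.apply_zero (pos_of_gt ht), h'.apply_zero (pos_of_gt ht')])
    (Set.right_mem_Icc.2 t.2)
  simpa using this

theorem continuous_of_lipschitzOnWith_closedBall {X : Type*} [NormedAddCommGroup X] {F : X → X}
    (hF : ∀ R : ℝ, ∃ K : ℝ≥0, LipschitzOnWith K F (Metric.closedBall 0 R)) : Continuous F := by
  refine continuous_iff_continuousAt.2 fun x => ?_
  obtain ⟨K, hK⟩ := hF (‖x‖ + 1)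
  exact hK.continuousOn.continuousAt
    (Filter.mem_of_superset (Metric.ball_mem_nhds x one_pos) fun y hy => by
      rw [Metric.mem_ball, dist_eq_norm] at hy
      rw [mem_closedBall_zero_iff]
      linarith [norm_le_norm_sub_add y x])

/-- Mild solutions exist on every bounded time interval. -/
def HasArbitrarilyLongMildSolutions (F : X → X) : Prop :=
  ∀ (x : X) (T : ℝ≥0), ∃ ξ : ℝ≥0 → X, IsMildSolution F x T ξ

variable [CompleteSpace X] {F : X → X}
  (hF : ∀ R : ℝ, ∃ K : ℝ≥0, LipschitzOnWith K F (Metric.closedBall 0 R))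
  (hE : HasArbitrarilyLongMildSolutions F)

include hF

theorem mildSystem_phi_eq {x : X} {T : ℝ≥0∞} {ξ : ℝ≥0 → X} (h : IsMildSolution F x T ξ)
    {t : ℝ≥0} (ht : (t : ℝ≥0∞) < T) (u : Unit) : (mildSystem F).phi t x u = ξ t := by
  have H : ∃ ξ : ℝ≥0 → X, ∃ T : ℝ≥0∞, (t : ℝ≥0∞) < T ∧ IsMildSolution F x T ξ := ⟨ξ, T, ht, h⟩
  simp only [mildSystem, dif_pos H]
  obtain ⟨T', hT', h'⟩ := H.choose_spec
  exact h'.eq_of_lt hF (continuous_of_lipschitzOnWith_closedBall hF) h hT' ht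

include hE

theorem isMildSolution_mildSystem_phi (x : X) (u : Unit) :
    IsMildSolution F x ⊤ (fun t => (mildSystem F).phi t x u) := by
  refine ⟨fun t _ => ContinuousAt.continuousWithinAt ?_, fun t _ => ?_⟩
  -- The horizon `t + 1` leaves a whole neighbourhood of `t` inside the interval of existence.
  · obtain ⟨ξ, hξ⟩ := hE x (t + 1)
    have hS : {s : ℝ≥0 | (s : ℝ≥0∞) < (t + 1 : ℝ≥0)} ∈ nhds t := by
      simp only [ENNReal.coe_lt_coe]
      exact Iio_mem_nhds (by simp)
    refine (hξ.1.continuousAt hS).congr ?_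
    filter_upwards [hS] with s hs using (mildSystem_phi_eq hF hξ hs u).symm
  · obtain ⟨ξ, hξ⟩ := hE x (t + 1)
    have hlt : (t : ℝ≥0∞) < (t + 1 : ℝ≥0) := by
      simp only [ENNReal.coe_lt_coe]; simp
    simp only
    rw [mildSystem_phi_eq hF hξ hlt, hξ.2 t hlt]
    congr 1
    refine intervalIntegral.integral_congr fun s hs => ?_
    rw [Set.uIcc_of_le t.coe_nonneg] at hs
    have hs' : (s.toNNReal : ℝ≥0∞) ≤ t := by
      exact_mod_cast Real.toNNReal_le_iff_le_coe.2 hs.2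
    simp only [mildSystem_phi_eq hF hξ (hs'.trans_lt hlt)]

theorem mildSystem_tmax_eq_top (x : X) (u : Unit) : (mildSystem F).tmax x u = ⊤ :=
  top_le_iff.1 (le_sSup ⟨_, isMildSolution_mildSystem_phi hF hE x u⟩)

theorem isUniqueMaximalMildSolution_mildSystem (x : X) (u : Unit) :
    IsUniqueMaximalMildSolution F x ((mildSystem F).tmax x u)
      (fun t => (mildSystem F).phi t x u) := by
  rw [mildSystem_tmax_eq_top hF hE]
  exact ⟨ENNReal.zero_lt_top, isMildSolution_mildSystem_phi hF hE x u, fun T' ξ' h' =>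
    ⟨le_top, fun t ht => (mildSystem_phi_eq hF h' ht u).symm⟩⟩

theorem mildSystem_phi_zero (x : X) (u : Unit) : (mildSystem F).phi 0 x u = x :=
  (isMildSolution_mildSystem_phi hF hE x u).apply_zero ENNReal.zero_lt_top

theorem continuous_mildSystem_phi (x : X) (u : Unit) :
    Continuous (fun t : ℝ≥0 => (mildSystem F).phi t x u) :=
  continuousOn_univ.1 ((isMildSolution_mildSystem_phi hF hE x u).1.mono fun _ _ => ENNReal.coe_lt_top)

/-- The time-shifted trajectory is a mild solution from the shifted state, so uniqueness identifies
the two. -/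
theorem mildSystem_phi_add (x : X) (u : Unit) (t s : ℝ≥0) :
    (mildSystem F).phi (t + s) x u = (mildSystem F).phi s ((mildSystem F).phi t x u) u := by
  have h := isMildSolution_mildSystem_phi hF hE x u
  have hc := continuous_mildSystem_phi hF hE x u
  have hi : Continuous fun r : ℝ => F ((mildSystem F).phi r.toNNReal x u) :=
    (continuous_of_lipschitzOnWith_closedBall hF).comp (hc.comp continuous_real_toNNReal)
  have hs : IsMildSolution F ((mildSystem F).phi t x u) ⊤
      (fun r => (mildSystem F).phi (t + r) x u) := by
    refine ⟨(hc.comp (continuous_const.add continuous_id)).continuousOn, fun r _ => ?_⟩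
    simp only
    have e₁ := h.2 (t + r) ENNReal.coe_lt_top
    have e₂ := h.2 t ENNReal.coe_lt_top
    simp only at e₁ e₂
    rw [e₁, e₂, add_assoc, NNReal.coe_add,
      ← intervalIntegral.integral_add_adjacent_intervals (hi.intervalIntegrable 0 (t : ℝ))
      (hi.intervalIntegrable (t : ℝ) (t + r))]
    congr 2
    have e₃ := intervalIntegral.integral_comp_add_left
      (fun q : ℝ => F ((mildSystem F).phi q.toNNReal x u)) (a := 0) (b := r) (t : ℝ)
    rw [add_zero] at e₃
    rw [← e₃]
    refine intervalIntegral.integral_congr fun q hq => ?_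
    rw [Set.uIcc_of_le r.coe_nonneg] at hq
    rw [Real.toNNReal_add t.coe_nonneg hq.1, Real.toNNReal_coe]
  exact (mildSystem_phi_eq hF hs ENNReal.coe_lt_top u).symm

theorem forwardComplete_mildSystem : (mildSystem F).ForwardComplete := fun x u _ => by
  rw [mildSystem_tmax_eq_top hF hE x u]; exact ENNReal.coe_lt_top

theorem isControlSystem_mildSystem : (mildSystem F).IsControlSystem where
  input_injective := Function.injective_of_subsingleton _
  shift_invariance u _ := ⟨u, fun _ => Subsingleton.elim _ _, le_rfl⟩
  restriction_invariance u _ _ _ := ⟨u, Subsingleton.elim _ _, le_rfl⟩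
  tmax_pos x u := by rw [mildSystem_tmax_eq_top hF hE]; exact ENNReal.zero_lt_top
  identity := mildSystem_phi_zero hF hE
  causality t x u v _ _ := ⟨forwardComplete_mildSystem hF hE x v t, rfl⟩
  cocycle x u v t s _ _ :=
    ⟨forwardComplete_mildSystem hF hE _ v s, mildSystem_phi_add hF hE x u t s⟩

theorem hasDerivWithinAt_mildSystem_phi (x : X) (u : Unit) {t : ℝ} (ht : 0 ≤ t) :
    HasDerivWithinAt (fun s : ℝ => (mildSystem F).phi s.toNNReal x u)
      (F ((mildSystem F).phi t.toNNReal x u)) (Set.Ici t) t :=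
  (isMildSolution_mildSystem_phi hF hE x u).hasDerivWithinAt
    (continuous_of_lipschitzOnWith_closedBall hF) ht ENNReal.coe_lt_top

end MildTheory

/-! ### A scalar barrier principle -/

section Scalar

/-- A barrier that `g` cannot cross since `g` does not grow while it lies in `[m, M]`. -/
theorem le_of_hasDerivWithinAt_nonpos_between {g g' : ℝ → ℝ} {a b m M : ℝ} (hmM : m < M)
    (hg : ContinuousOn g (Set.Icc a b))
    (hg' : ∀ t ∈ Set.Ico a b, HasDerivWithinAt g (g' t) (Set.Ici t) t) (ha : g a ≤ m)
    (H : ∀ t ∈ Set.Ico a b, m ≤ g t → g t ≤ M → g' t ≤ 0) :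
    ∀ t ∈ Set.Icc a b, g t ≤ m := by
  intro t ht
  have hab : 0 ≤ b - a := by linarith [ht.1, ht.2]
  refine le_of_forall_pos_le_add fun ε hε => ?_
  set δ := min ε (M - m) with hδ
  have hδ0 : 0 < δ := lt_min hε (by linarith)
  set η := δ / (b - a + 1) with hη
  have hη0 : 0 < η := by positivity
  have hηb : ∀ s ∈ Set.Icc a b, η * (s - a) ≤ δ := by
    intro s hs
    have h1 : η * (b - a + 1) = δ := by rw [hη]; field_simp
    nlinarith [hs.1, hs.2]
  have key := image_le_of_deriv_right_lt_deriv_boundary hg hg'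
    (B := fun s => m + η * (s - a)) (B' := fun _ => η) (by simpa using ha)
    (fun s => by simpa using (((hasDerivAt_id s).sub_const a).const_mul η).const_add m)
    (fun s hs hsB => by
      have h1 := hηb s ⟨hs.1, hs.2.le⟩
      have h2 : δ ≤ M - m := min_le_right _ _
      have h3 : 0 ≤ η * (s - a) := mul_nonneg hη0.le (by linarith [hs.1])
      exact (H s hs (by linarith) (by linarith)).trans_lt hη0) ht
  have h1 := hηb t ht
  have h2 : δ ≤ ε := min_le_left _ _
  linarith

end Scalar

/-! ### Coordinates and norms in `ℓ²` -/

section EllTwoFacts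

theorem EllTwo.hasSum_sq (x : EllTwo) : HasSum (fun n => x n ^ 2) (‖x‖ ^ 2) := by
  have := lp.hasSum_norm (p := 2) (by norm_num) x
  simpa using this

theorem EllTwo.abs_apply_le (x : EllTwo) (n : ℕ) : |x n| ≤ ‖x‖ := by
  simpa using lp.norm_apply_le_norm (by norm_num) x n

theorem EllTwo.norm_sq_le {x y z : EllTwo} {a b : ℝ}
    (h : ∀ n, z n ^ 2 ≤ a * x n ^ 2 + b * y n ^ 2) : ‖z‖ ^ 2 ≤ a * ‖x‖ ^ 2 + b * ‖y‖ ^ 2 :=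
  hasSum_le h z.hasSum_sq ((x.hasSum_sq.mul_left a).add (y.hasSum_sq.mul_left b))

theorem EllTwo.norm_sq_le_mul {x z : EllTwo} {a : ℝ} (h : ∀ n, z n ^ 2 ≤ a * x n ^ 2) :
    ‖z‖ ^ 2 ≤ a * ‖x‖ ^ 2 :=
  hasSum_le h z.hasSum_sq (x.hasSum_sq.mul_left a)

end EllTwoFacts

/-! ### Componentwise estimates of the vector field -/

section Rhs

theorem exampleRhs_zero (x : ℕ → ℝ) : exampleRhs x 0 = -x 0 := by simp [exampleRhs]

theorem exampleRhs_of_ne_zero (x : ℕ → ℝ) {n : ℕ} (hn : n ≠ 0) :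
    exampleRhs x n = -x n + x n ^ 2 * x 0 - x n * |x n| - 1 / (n : ℝ) ^ 2 * x n ^ 3 := by
  simp [exampleRhs, hn]

theorem one_div_natCast_sq_mem {n : ℕ} (hn : n ≠ 0) : 0 ≤ 1 / (n : ℝ) ^ 2 ∧ 1 / (n : ℝ) ^ 2 ≤ 1 := by
  have : (1 : ℝ) ≤ (n : ℝ) ^ 2 := by
    exact_mod_cast Nat.one_le_iff_ne_zero.2 (pow_ne_zero 2 hn)
  exact ⟨by positivity, by rw [div_le_one (by linarith)]; exact this⟩

theorem mul_exampleRhs_le (x : ℕ → ℝ) {n : ℕ} (hn : n ≠ 0) :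
    x n * exampleRhs x n ≤
      |x n| ^ 2 * (-1 + |x n| * |x 0| - |x n| - 1 / (n : ℝ) ^ 2 * |x n| ^ 2) := by
  rw [exampleRhs_of_ne_zero x hn]
  have h1 : x n * x 0 ≤ |x n| * |x 0| := by rw [← abs_mul]; exact le_abs_self _
  have h2 := mul_le_mul_of_nonneg_left h1 (sq_nonneg (x n))
  have h3 := sq_abs (x n)
  rw [h3]
  nlinarith

theorem mul_exampleRhs_le_neg_sq {x : ℕ → ℝ} (h : |x 0| ≤ 1) (n : ℕ) :
    x n * exampleRhs x n ≤ -(x n) ^ 2 := by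
  rcases eq_or_ne n 0 with rfl | hn
  · rw [exampleRhs_zero]; nlinarith
  · refine (mul_exampleRhs_le x hn).trans ?_
    rw [← sq_abs (x n)]
    have h0 := abs_nonneg (x n)
    have h1 : |x n| * |x 0| ≤ |x n| := mul_le_of_le_one_right h0 h
    have h2 : 0 ≤ 1 / (n : ℝ) ^ 2 * |x n| ^ 2 :=
      mul_nonneg (one_div_natCast_sq_mem hn).1 (sq_nonneg _)
    nlinarith [mul_nonneg (sq_nonneg |x n|) (sub_nonneg.2 h1), mul_nonneg (sq_nonneg |x n|) h2]

/-- At low amplitude the linear damping alone dominates the coupling. -/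
theorem mul_exampleRhs_nonpos_of_small {x : ℕ → ℝ} {D : ℝ} (h : |x 0| ≤ D) {n : ℕ} (hn : n ≠ 0)
    (hx : |x n| * D ≤ 1) : x n * exampleRhs x n ≤ 0 := by
  refine (mul_exampleRhs_le x hn).trans (mul_nonpos_of_nonneg_of_nonpos (sq_nonneg _) ?_)
  have h1 := mul_le_mul_of_nonneg_left h (abs_nonneg (x n))
  have h2 : 0 ≤ 1 / (n : ℝ) ^ 2 * |x n| ^ 2 :=
    mul_nonneg (one_div_natCast_sq_mem hn).1 (sq_nonneg _)
  linarith [abs_nonneg (x n)]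

/-- At high amplitude the cubic damping dominates the coupling; the threshold grows like `n²`. -/
theorem mul_exampleRhs_nonpos_of_large {x : ℕ → ℝ} {D : ℝ} (h : |x 0| ≤ D) {n : ℕ} (hn : n ≠ 0)
    (hx : (n : ℝ) ^ 2 * D ≤ |x n|) : x n * exampleRhs x n ≤ 0 := by
  refine (mul_exampleRhs_le x hn).trans (mul_nonpos_of_nonneg_of_nonpos (sq_nonneg _) ?_)
  have h1 := mul_le_mul_of_nonneg_left h (abs_nonneg (x n))
  have hn' : (0 : ℝ) < (n : ℝ) ^ 2 := by positivity
  have h2 : D ≤ 1 / (n : ℝ) ^ 2 * |x n| := by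
    rw [one_div, inv_mul_eq_div, le_div_iff₀ hn']; linarith
  have h3 := mul_le_mul_of_nonneg_left h2 (abs_nonneg (x n))
  nlinarith [abs_nonneg (x n)]

theorem mul_exampleRhs_le_neg_cube {x : ℕ → ℝ} (h : |x 0| ≤ 1 / 2) {n : ℕ} (hn : n ≠ 0) :
    x n * exampleRhs x n ≤ -(|x n| ^ 3 / 2) := by
  refine (mul_exampleRhs_le x hn).trans ?_
  have h0 := abs_nonneg (x n)
  have h1 := mul_le_mul_of_nonneg_left h h0
  have h2 : 0 ≤ 1 / (n : ℝ) ^ 2 * |x n| ^ 2 :=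
    mul_nonneg (one_div_natCast_sq_mem hn).1 (sq_nonneg _)
  have h3 : -1 + |x n| * |x 0| - |x n| - 1 / (n : ℝ) ^ 2 * |x n| ^ 2 ≤ -(|x n| / 2) := by linarith
  nlinarith [mul_le_mul_of_nonneg_left h3 (sq_nonneg |x n|)]

/-- The second term comes from varying `x₀`, which affects all modes at once; the factor `|y n|` is
retained because it makes the bound square-summable in `n`. -/
theorem abs_exampleRhs_sub_le {x y : EllTwo} {R : ℝ} (hx : ‖x‖ ≤ R) (hy : ‖y‖ ≤ R) (n : ℕ) :
    |exampleRhs x n - exampleRhs y n| ≤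
      (1 + 2 * R + 5 * R ^ 2) * |x n - y n| + R * ‖x - y‖ * |y n| := by
  have hR : 0 ≤ R := (norm_nonneg x).trans hx
  have hd := abs_nonneg (x n - y n)
  rcases eq_or_ne n 0 with rfl | hn
  · rw [exampleRhs_zero, exampleRhs_zero, show -x 0 - -y 0 = -(x 0 - y 0) by ring, abs_neg]
    have : 0 ≤ R * ‖x - y‖ * |y 0| := by positivity
    nlinarith [mul_nonneg hR hd, mul_nonneg (sq_nonneg R) hd]
  · obtain ⟨k0, k1⟩ := one_div_natCast_sq_mem hn
    rw [exampleRhs_of_ne_zero _ hn, exampleRhs_of_ne_zero _ hn]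
    set k := 1 / (n : ℝ) ^ 2
    have ax := (x.abs_apply_le n).trans hx
    have ay := (y.abs_apply_le n).trans hy
    have ax0 := (x.abs_apply_le 0).trans hx
    have a0 : |x 0 - y 0| ≤ ‖x - y‖ := (x - y).abs_apply_le 0
    have e : -x n + x n ^ 2 * x 0 - x n * |x n| - k * x n ^ 3 -
        (-y n + y n ^ 2 * y 0 - y n * |y n| - k * y n ^ 3) =
        (-1 + (x n + y n) * x 0 - |x n| - k * (x n ^ 2 + x n * y n + y n ^ 2)) * (x n - y n)
          + y n ^ 2 * (x 0 - y 0) - y n * (|x n| - |y n|) := by ring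
    rw [e]
    have t1 : |y n ^ 2 * (x 0 - y 0)| ≤ R * ‖x - y‖ * |y n| := by
      rw [abs_mul, abs_pow]
      calc |y n| ^ 2 * |x 0 - y 0| = |y n| * |x 0 - y 0| * |y n| := by ring
        _ ≤ R * ‖x - y‖ * |y n| := by gcongr
    have t2 : |y n * (|x n| - |y n|)| ≤ R * |x n - y n| := by
      rw [abs_mul]
      exact mul_le_mul ay (abs_abs_sub_abs_le _ _) (abs_nonneg _) hR
    have t3 : |-1 + (x n + y n) * x 0 - |x n| - k * (x n ^ 2 + x n * y n + y n ^ 2)| ≤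
        1 + R + 5 * R ^ 2 := by
      have s1 : |(x n + y n) * x 0| ≤ 2 * R ^ 2 := by
        rw [abs_mul]
        calc |x n + y n| * |x 0| ≤ (R + R) * R :=
              mul_le_mul ((abs_add_le _ _).trans (add_le_add ax ay)) ax0 (abs_nonneg _) (by linarith)
          _ = 2 * R ^ 2 := by ring
      have s2 : |x n ^ 2 + x n * y n + y n ^ 2| ≤ 3 * R ^ 2 := by
        rw [abs_le] at ax ay
        rw [abs_le]
        constructor <;> nlinarith [sq_nonneg (x n + y n), sq_nonneg (x n), sq_nonneg (y n)]
      have s3 : |k * (x n ^ 2 + x n * y n + y n ^ 2)| ≤ 3 * R ^ 2 := by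
        rw [abs_mul, abs_of_nonneg k0]
        exact (mul_le_of_le_one_left (abs_nonneg _) k1).trans s2
      have p := abs_nonneg (x n)
      rw [abs_le] at s1 s3 ⊢
      constructor <;> linarith [s1.1, s1.2, s3.1, s3.2]
    have t4 := mul_le_mul_of_nonneg_right t3 hd
    rw [← abs_mul] at t4
    refine (abs_sub _ _).trans ?_
    refine (add_le_add ((abs_add_le _ _).trans (add_le_add t4 t1)) t2).trans (le_of_eq ?_)
    ring

theorem lipschitzOnWith_exampleField (R : ℝ) :
    ∃ K : ℝ≥0, LipschitzOnWith K exampleField (Metric.closedBall 0 R) := by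
  refine ⟨(2 * (1 + 2 * R + 5 * R ^ 2) + 2 * R ^ 2).toNNReal,
    LipschitzOnWith.of_dist_le_mul fun x hx y hy => ?_⟩
  rw [mem_closedBall_zero_iff] at hx hy
  have hR : 0 ≤ R := (norm_nonneg x).trans hx
  rw [Real.coe_toNNReal _ (by positivity), dist_eq_norm, dist_eq_norm]
  set C := 1 + 2 * R + 5 * R ^ 2 with hC
  have hC0 : 0 ≤ C := by positivity
  have h : ‖exampleField x - exampleField y‖ ^ 2 ≤
      2 * C ^ 2 * ‖x - y‖ ^ 2 + 2 * (R * ‖x - y‖) ^ 2 * ‖y‖ ^ 2 := by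
    refine EllTwo.norm_sq_le fun n => ?_
    have h1 := abs_exampleRhs_sub_le hx hy n
    have h2 := pow_le_pow_left₀ (abs_nonneg _) h1 2
    rw [sq_abs] at h2
    refine (h2.trans (add_sq_le)).trans (le_of_eq ?_)
    rw [mul_pow, mul_pow _ |y n|, sq_abs, sq_abs]
    simp only [lp.coeFn_sub, Pi.sub_apply]
    ring
  refine le_of_sq_le_sq ?_ (by positivity)
  have hy2 : ‖y‖ ^ 2 ≤ R ^ 2 := by gcongr
  have h3 : 2 * (R * ‖x - y‖) ^ 2 * ‖y‖ ^ 2 ≤ 2 * (R * ‖x - y‖) ^ 2 * R ^ 2 := by gcongr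
  refine (h.trans (by gcongr)).trans (?_ : 2 * C ^ 2 * ‖x - y‖ ^ 2 + 2 * (R * ‖x - y‖) ^ 2 * R ^ 2 ≤ _)
  have h4 : 0 ≤ C * R ^ 2 * ‖x - y‖ ^ 2 := by positivity
  have h5 : 0 ≤ C ^ 2 * ‖x - y‖ ^ 2 := by positivity
  have h6 : 0 ≤ R ^ 2 * R ^ 2 * ‖x - y‖ ^ 2 := by positivity
  nlinarith

end Rhs

/-! ### Barriers and decay along trajectories -/

section Trajectories

/-- `α` solves `α' = c(t) F(α)` on `[a, b]` with a nonnegative scalar factor `c`. -/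
structure IsScaledTrajectory (c : ℝ → ℝ) (α : ℝ → EllTwo) (a b : ℝ) : Prop where
  continuousOn : ContinuousOn α (Set.Icc a b)
  nonneg : ∀ t ∈ Set.Ico a b, 0 ≤ c t
  hasDerivWithinAt : ∀ t ∈ Set.Ico a b,
    HasDerivWithinAt α (c t • exampleField (α t)) (Set.Ici t) t

namespace IsScaledTrajectory

variable {c : ℝ → ℝ} {α : ℝ → EllTwo} {a b : ℝ}

theorem continuousOn_apply (h : IsScaledTrajectory c α a b) (n : ℕ) :
    ContinuousOn (fun t => α t n) (Set.Icc a b) :=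
  (lp.evalCLM ℝ (fun _ : ℕ => ℝ) 2 n).continuous.comp_continuousOn h.continuousOn

theorem hasDerivWithinAt_apply (h : IsScaledTrajectory c α a b) (n : ℕ) {t : ℝ}
    (ht : t ∈ Set.Ico a b) :
    HasDerivWithinAt (fun s => α s n) (c t * exampleRhs (α t) n) (Set.Ici t) t :=
  (lp.evalCLM ℝ (fun _ : ℕ => ℝ) 2 n).hasFDerivAt.comp_hasDerivWithinAt t (h.hasDerivWithinAt t ht)

theorem hasDerivWithinAt_sq (h : IsScaledTrajectory c α a b) (n : ℕ) {t : ℝ}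
    (ht : t ∈ Set.Ico a b) :
    HasDerivWithinAt (fun s => α s n ^ 2) (2 * c t * (α t n * exampleRhs (α t) n))
      (Set.Ici t) t := by
  refine ((h.hasDerivWithinAt_apply n ht).fun_pow 2).congr_deriv ?_
  simp only [Nat.cast_ofNat, Nat.add_one_sub_one, pow_one]
  ring

theorem sq_apply_le (h : IsScaledTrajectory c α a b) {n : ℕ} {m M : ℝ} (hmM : m < M)
    (ha : α a n ^ 2 ≤ m)
    (H : ∀ t ∈ Set.Ico a b, m ≤ α t n ^ 2 → α t n ^ 2 ≤ M → α t n * exampleRhs (α t) n ≤ 0) :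
    ∀ t ∈ Set.Icc a b, α t n ^ 2 ≤ m :=
  le_of_hasDerivWithinAt_nonpos_between hmM ((h.continuousOn_apply n).pow 2)
    (fun _ ht => h.hasDerivWithinAt_sq n ht) ha fun t ht h₁ h₂ =>
      mul_nonpos_of_nonneg_of_nonpos (mul_nonneg zero_le_two (h.nonneg t ht)) (H t ht h₁ h₂)

theorem sq_apply_zero_le (h : IsScaledTrajectory c α a b) :
    ∀ t ∈ Set.Icc a b, α t 0 ^ 2 ≤ α a 0 ^ 2 :=
  h.sq_apply_le (lt_add_one _) le_rfl fun t _ _ _ => by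
    rw [exampleRhs_zero]; nlinarith [sq_nonneg (α t 0)]

theorem abs_apply_zero_le (h : IsScaledTrajectory c α a b) {t : ℝ} (ht : t ∈ Set.Icc a b) :
    |α t 0| ≤ |α a 0| := sq_le_sq.1 (h.sq_apply_zero_le t ht)

theorem sq_apply_le_of_small (h : IsScaledTrajectory c α a b) {D : ℝ} (hD : 0 < D)
    (h0 : |α a 0| ≤ D) {n : ℕ} (hn : 2 * D * |α a n| ≤ 1) :
    ∀ t ∈ Set.Icc a b, α t n ^ 2 ≤ α a n ^ 2 := by
  rcases eq_or_ne n 0 with rfl | hn0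
  · exact h.sq_apply_zero_le
  -- The factor 2 in the hypothesis leaves a gap between the initial level and the threshold `1 /
  -- D`, as the barrier principle requires.
  have hlt : α a n ^ 2 < (1 / D) ^ 2 := by
    refine sq_lt_sq' ?_ ?_ <;>
    · have h1 : |α a n| < 1 / D := by
        rw [lt_div_iff₀ hD]; nlinarith [abs_nonneg (α a n)]
      linarith [(abs_lt.1 h1).1, (abs_lt.1 h1).2]
  refine h.sq_apply_le hlt le_rfl fun t ht _ h2 =>
    mul_exampleRhs_nonpos_of_small ((h.abs_apply_zero_le ⟨ht.1, ht.2.le⟩).trans h0) hn0 ?_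
  rw [← le_div_iff₀ hD]
  exact abs_le_of_sq_le_sq h2 (by positivity)

theorem sq_apply_le_of_pow_mul_le (h : IsScaledTrajectory c α a b) {D m : ℝ} (hm : 0 ≤ m)
    (h0 : |α a 0| ≤ D) {n : ℕ} (hn : |α a n| ≤ m) (hnm : (n : ℝ) ^ 2 * D ≤ m) :
    ∀ t ∈ Set.Icc a b, α t n ^ 2 ≤ m ^ 2 := by
  have ha : α a n ^ 2 ≤ m ^ 2 := sq_le_sq' (abs_le.1 hn).1 (abs_le.1 hn).2
  rcases eq_or_ne n 0 with rfl | hn0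
  · exact fun t ht => (h.sq_apply_zero_le t ht).trans ha
  refine h.sq_apply_le (lt_add_one _) ha fun t ht h1 _ =>
    mul_exampleRhs_nonpos_of_large ((h.abs_apply_zero_le ⟨ht.1, ht.2.le⟩).trans h0) hn0
      (hnm.trans ?_)
  rw [← abs_of_nonneg hm]
  exact sq_le_sq.1 h1

theorem apply_zero_eq (h : IsScaledTrajectory (fun _ => 1) α a b) {t : ℝ}
    (ht : t ∈ Set.Icc a b) : α t 0 = Real.exp (-(t - a)) * α a 0 := by
  have := constant_of_has_deriv_right_zero (f := fun s => Real.exp (s - a) * α s 0)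
    ((Real.continuous_exp.comp (continuous_id.sub continuous_const)).continuousOn.mul
      (h.continuousOn_apply 0))
    (fun s hs => by
      have e : HasDerivWithinAt (fun s => Real.exp (s - a)) (Real.exp (s - a)) (Set.Ici s) s := by
        simpa using ((hasDerivAt_id s).sub_const a).exp.hasDerivWithinAt
      refine (e.fun_mul (h.hasDerivWithinAt_apply 0 hs)).congr_deriv ?_
      rw [exampleRhs_zero]
      ring) t ht
  simp only [sub_self, Real.exp_zero, one_mul] at this
  rw [← this, ← mul_assoc, ← Real.exp_add]
  simp

theorem sq_apply_le_exp (h : IsScaledTrajectory (fun _ => 1) α a b) (h0 : |α a 0| ≤ 1) (n : ℕ)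
    {t : ℝ} (ht : t ∈ Set.Icc a b) :
    α t n ^ 2 ≤ Real.exp (-(t - a)) ^ 2 * α a n ^ 2 := by
  have := le_of_hasDerivWithinAt_nonpos_between (m := α a n ^ 2) (M := α a n ^ 2 + 1)
    (g := fun s => Real.exp (2 * (s - a)) * α s n ^ 2)
    (g' := fun s => 2 * Real.exp (2 * (s - a)) * (α s n ^ 2 + α s n * exampleRhs (α s) n))
    (lt_add_one _)
    ((Real.continuous_exp.comp
      (continuous_const.mul (continuous_id.sub continuous_const))).continuousOn.mul
      ((h.continuousOn_apply n).pow 2))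
    (fun s hs => by
      have e : HasDerivWithinAt (fun s => Real.exp (2 * (s - a)))
          (Real.exp (2 * (s - a)) * 2) (Set.Ici s) s := by
        simpa using (((hasDerivAt_id s).sub_const a).const_mul 2).exp.hasDerivWithinAt
      exact (e.fun_mul (h.hasDerivWithinAt_sq n hs)).congr_deriv (by ring))
    (by simp)
    (fun s hs _ _ => by
      have := mul_exampleRhs_le_neg_sq
        ((h.abs_apply_zero_le ⟨hs.1, hs.2.le⟩).trans h0) n
      refine mul_nonpos_of_nonneg_of_nonpos (by positivity) (by linarith)) t ht
  simp only at this
  have e : Real.exp (-(t - a)) ^ 2 * Real.exp (2 * (t - a)) = 1 := by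
    rw [← Real.exp_nat_mul, ← Real.exp_add, Real.exp_eq_one_iff]
    push_cast
    ring
  calc α t n ^ 2 = Real.exp (-(t - a)) ^ 2 * (Real.exp (2 * (t - a)) * α t n ^ 2) := by
        rw [← mul_assoc, e, one_mul]
    _ ≤ _ := by gcongr

theorem norm_le_exp (h : IsScaledTrajectory (fun _ => 1) α a b) (h0 : |α a 0| ≤ 1)
    {t : ℝ} (ht : t ∈ Set.Icc a b) : ‖α t‖ ≤ Real.exp (-(t - a)) * ‖α a‖ := by
  refine le_of_sq_le_sq ?_ (by positivity)
  rw [mul_pow]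
  exact EllTwo.norm_sq_le_mul fun n => h.sq_apply_le_exp h0 n ht

/-- Comparison with `v' = -v²/2`, whose positive solutions lie below `2/(t - a)` for every initial
value. -/
theorem sq_mul_sq_apply_le (h : IsScaledTrajectory (fun _ => 1) α a b) (h0 : |α a 0| ≤ 1 / 2)
    {n : ℕ} (hn : n ≠ 0) {t : ℝ} (ht : t ∈ Set.Icc a b) :
    (t - a) ^ 2 * α t n ^ 2 ≤ 4 := by
  have := le_of_hasDerivWithinAt_nonpos_between (m := 4) (M := 5)
    (g := fun s => (s - a) ^ 2 * α s n ^ 2)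
    (g' := fun s => 2 * (s - a) * α s n ^ 2 + (s - a) ^ 2 * (2 * (α s n * exampleRhs (α s) n)))
    (by norm_num)
    (((continuous_id.sub continuous_const).pow 2).continuousOn.mul
      ((h.continuousOn_apply n).pow 2))
    (fun s hs => by
      have e : HasDerivWithinAt (fun s => (s - a) ^ 2) (2 * (s - a)) (Set.Ici s) s := by
        simpa using (((hasDerivAt_id s).sub_const a).fun_pow 2).hasDerivWithinAt
      exact (e.fun_mul (h.hasDerivWithinAt_sq n hs)).congr_deriv (by ring))
    (by simp)
    (fun s hs h4 _ => by
      have h1 := mul_exampleRhs_le_neg_cube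
        ((h.abs_apply_zero_le ⟨hs.1, hs.2.le⟩).trans h0) hn
      have hs0 : 0 ≤ s - a := by linarith [hs.1]
      -- Above level 4 the damping `-(s - a)²|xₙ|³` outweighs `2(s - a)xₙ²`, the growth of the
      -- weight.
      have h2 : 2 ≤ (s - a) * |α s n| := by
        refine le_of_sq_le_sq ?_ (by positivity)
        rw [mul_pow, sq_abs]; linarith
      have h3 := mul_le_mul_of_nonneg_left h1 (sq_nonneg (s - a))
      have h5 := mul_nonneg (mul_nonneg hs0 (sq_nonneg |α s n|)) (sub_nonneg.2 h2)
      rw [← sq_abs (α s n)]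
      nlinarith) t ht
  exact this

end IsScaledTrajectory

end Trajectories

/-! ### Global existence by cutoff and a priori bound -/

section Existence

/-- A nonnegative cutoff: `1` on the closed ball of radius `R`, `0` outside the one of radius
`R + 1`. -/
noncomputable def ballCutoff (R : ℝ) (x : EllTwo) : ℝ := max 0 (min 1 (R + 1 - ‖x‖))

theorem ballCutoff_nonneg (R : ℝ) (x : EllTwo) : 0 ≤ ballCutoff R x := le_max_left _ _

theorem ballCutoff_le_one (R : ℝ) (x : EllTwo) : ballCutoff R x ≤ 1 :=
  max_le zero_le_one (min_le_left _ _)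

theorem ballCutoff_eq_one {R : ℝ} {x : EllTwo} (h : ‖x‖ ≤ R) : ballCutoff R x = 1 := by
  rw [ballCutoff, min_eq_left (by linarith), max_eq_right zero_le_one]

theorem ballCutoff_eq_zero {R : ℝ} {x : EllTwo} (h : R + 1 ≤ ‖x‖) : ballCutoff R x = 0 :=
  max_eq_left ((min_le_right _ _).trans (by linarith))

theorem abs_ballCutoff_sub_le (R : ℝ) (x y : EllTwo) :
    |ballCutoff R x - ballCutoff R y| ≤ ‖x - y‖ := by
  have h := abs_le.1 (abs_norm_sub_norm_le x y)
  have h0 := norm_nonneg (x - y)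
  simp only [ballCutoff, max_def, min_def]
  rw [abs_le]
  split_ifs <;> constructor <;> linarith [h.1, h.2]

theorem exists_bound_lipschitz_cutoff_exampleField (R : ℝ) : ∃ L K : ℝ≥0,
    (∀ x, ‖ballCutoff R x • exampleField x‖ ≤ L) ∧
      LipschitzWith K (fun x => ballCutoff R x • exampleField x) := by
  obtain ⟨K, hK⟩ := lipschitzOnWith_exampleField (R + 1)
  have hb : ∃ L : ℝ≥0, ∀ x : EllTwo, ‖x‖ ≤ R + 1 → ‖exampleField x‖ ≤ L := by
    refine ⟨(K * (R + 1) + ‖exampleField 0‖).toNNReal, fun x hx => ?_⟩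
    have h0 : (0 : ℝ) ≤ R + 1 := (norm_nonneg x).trans hx
    rw [Real.coe_toNNReal _ (by positivity)]
    have h1 := hK.norm_sub_le (mem_closedBall_zero_iff.2 hx)
      (mem_closedBall_zero_iff.2 (by simpa using h0) : (0 : EllTwo) ∈ _)
    rw [sub_zero] at h1
    have h2 : (K : ℝ) * ‖x‖ ≤ K * (R + 1) := by gcongr
    linarith [norm_le_norm_sub_add (exampleField x) (exampleField 0)]
  obtain ⟨L, hL⟩ := hb
  refine ⟨L, L + K, fun x => ?_, LipschitzWith.of_dist_le_mul fun x y => ?_⟩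
  · rw [norm_smul, Real.norm_of_nonneg (ballCutoff_nonneg R x)]
    rcases le_total ‖x‖ (R + 1) with h | h
    · exact (mul_le_of_le_one_left (norm_nonneg _) (ballCutoff_le_one R x)).trans (hL x h)
    · rw [ballCutoff_eq_zero h, zero_mul]; exact L.2
  · rw [dist_eq_norm, dist_eq_norm, NNReal.coe_add]
    have hd := norm_nonneg (x - y)
    have hKd : 0 ≤ (K : ℝ) * ‖x - y‖ := by positivity
    -- Since the cutoff vanishes at `y`, its value at `x` is at most `‖x - y‖`; no bound on the
    -- field at `y` is needed.
    have outside : ∀ x y : EllTwo, ‖x‖ ≤ R + 1 → R + 1 ≤ ‖y‖ →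
        ‖ballCutoff R x • exampleField x - ballCutoff R y • exampleField y‖ ≤ L * ‖x - y‖ := by
      intro x y hx hy
      have h1 := abs_ballCutoff_sub_le R x y
      rw [ballCutoff_eq_zero hy] at h1 ⊢
      rw [sub_zero] at h1
      rw [zero_smul, sub_zero, norm_smul, mul_comm]
      exact mul_le_mul (hL x hx) h1 (norm_nonneg _) L.2
    rcases le_total ‖x‖ (R + 1) with hx | hx <;> rcases le_total ‖y‖ (R + 1) with hy | hy
    · have e : ballCutoff R x • exampleField x - ballCutoff R y • exampleField y =
          (ballCutoff R x - ballCutoff R y) • exampleField x +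
            ballCutoff R y • (exampleField x - exampleField y) := by
        rw [sub_smul, smul_sub]; abel
      rw [e]
      refine (norm_add_le _ _).trans ?_
      rw [norm_smul, norm_smul, Real.norm_of_nonneg (ballCutoff_nonneg R y), add_mul,
        mul_comm (L : ℝ)]
      refine add_le_add (mul_le_mul (abs_ballCutoff_sub_le R x y) (hL x hx) (norm_nonneg _) hd) ?_
      exact (mul_le_of_le_one_left (norm_nonneg _) (ballCutoff_le_one R y)).trans
        (hK.norm_sub_le (mem_closedBall_zero_iff.2 hx) (mem_closedBall_zero_iff.2 hy))
    · linarith [outside x y hx hy]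
    · rw [norm_sub_rev, norm_sub_rev x y] at *
      linarith [outside y x hy hx]
    · rw [ballCutoff_eq_zero hx, ballCutoff_eq_zero hy, zero_smul, zero_smul, sub_zero, norm_zero]
      positivity

/-- A priori bound, independent of the scaling factor and of the length of the time interval. -/
theorem exists_norm_bound_scaledTrajectory (x : EllTwo) : ∃ R : ℝ, ∀ (c : ℝ → ℝ)
    (α : ℝ → EllTwo) (a b : ℝ), IsScaledTrajectory c α a b → α a = x →
      ∀ t ∈ Set.Icc a b, ‖α t‖ ≤ R := by
  set D := ‖x‖ + 1 with hD
  have hD0 : 0 < D := by positivity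
  have hlim : Filter.Tendsto (fun n => x n ^ 2) Filter.atTop (nhds 0) :=
    x.hasSum_sq.summable.tendsto_atTop_zero
  obtain ⟨N, hN⟩ := Filter.eventually_atTop.1
    (hlim.eventually_lt_const (show (0 : ℝ) < (1 / (2 * D)) ^ 2 by positivity))
  have hx0 : |x 0| ≤ D := (x.abs_apply_le 0).trans (by linarith)
  -- For the finitely many modes with `2D|xₙ| ≥ 1`, the barrier `n²D` is at most `N²D · 2D|xₙ|`,
  -- hence at most `C|xₙ|`.
  set C := 1 + 2 * (N : ℝ) ^ 2 * D ^ 2 with hC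
  have hC1 : 1 ≤ C := by rw [hC]; nlinarith [show 0 ≤ 2 * (N : ℝ) ^ 2 * D ^ 2 by positivity]
  refine ⟨C * ‖x‖, fun c α a b h hx t ht => ?_⟩
  subst hx
  refine le_of_sq_le_sq ?_ (by positivity)
  rw [mul_pow]
  refine EllTwo.norm_sq_le_mul fun n => ?_
  rcases le_total (2 * D * |α a n|) 1 with hn | hn
  · refine (h.sq_apply_le_of_small hD0 hx0 hn t ht).trans ?_
    exact le_mul_of_one_le_left (sq_nonneg _) (one_le_pow₀ hC1)
  · have hnN : n ≤ N := by
      by_contra! hlt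
      have h1 := abs_lt_of_sq_lt_sq (hN n hlt.le) (by positivity)
      rw [lt_div_iff₀ (by positivity)] at h1
      linarith
    have hnN' : (n : ℝ) ≤ N := by exact_mod_cast hnN
    rw [← sq_abs (α a n), ← mul_pow]
    refine h.sq_apply_le_of_pow_mul_le (D := D) (by positivity) hx0
      (le_mul_of_one_le_left (abs_nonneg _) hC1) ?_ t ht
    calc (n : ℝ) ^ 2 * D ≤ (N : ℝ) ^ 2 * D := by gcongr
      _ ≤ (N : ℝ) ^ 2 * D * (2 * D * |α a n|) := le_mul_of_one_le_right (by positivity) hn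
      _ = (C - 1) * |α a n| := by rw [hC]; ring
      _ ≤ C * |α a n| := by gcongr; linarith

/-- The cutoff only rescales the field by a nonnegative factor, so the a priori bound `R` holds for
the cut-off equation too. Its solutions never leave the ball where the cutoff is 1, and so solve the
original equation. -/
theorem hasArbitrarilyLongMildSolutions_exampleField :
    HasArbitrarilyLongMildSolutions exampleField := by
  intro x T
  obtain ⟨R, hR⟩ := exists_norm_bound_scaledTrajectory x
  obtain ⟨L, K, hL, hK⟩ := exists_bound_lipschitz_cutoff_exampleField R
  -- The cut-off field is bounded by `L` and globally Lipschitz, so radius `L * T` admits the whole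
  -- interval `[0, T]`.
  have hP : IsPicardLindelof (fun _ y => ballCutoff R y • exampleField y)
      (⟨0, le_rfl, T.coe_nonneg⟩ : Set.Icc (0 : ℝ) T) x (L * T) 0 L K :=
    .of_time_independent (fun y _ => hL y) hK.lipschitzOnWith (by simp)
  obtain ⟨α, hα0, hα⟩ := hP.exists_eq_forall_mem_Icc_hasDerivWithinAt₀
  simp only at hα0
  have hc : ContinuousOn α (Set.Icc 0 T) := fun t ht => (hα t ht).continuousWithinAt
  have htraj : IsScaledTrajectory (fun t => ballCutoff R (α t)) α 0 T :=
    ⟨hc, fun t _ => ballCutoff_nonneg _ _, fun t ht =>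
      (hα t ⟨ht.1, ht.2.le⟩).mono_of_mem_nhdsWithin (Icc_mem_nhdsGE_of_mem ht)⟩
  have hle := hR _ _ _ _ htraj hα0
  have hF := continuous_of_lipschitzOnWith_closedBall lipschitzOnWith_exampleField
  refine ⟨fun t => α t, ?_, fun t ht => ?_⟩
  · refine hc.comp NNReal.continuous_coe.continuousOn fun t ht => ⟨t.coe_nonneg, ?_⟩
    have : t < T := by simpa using ht
    exact_mod_cast this.le
  · have htT : (t : ℝ) ≤ T := by
      have : t < T := by simpa using ht
      exact_mod_cast this.le
    have hsub : Set.Icc (0 : ℝ) t ⊆ Set.Icc 0 T := Set.Icc_subset_Icc_right htT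
    have := intervalIntegral.integral_eq_sub_of_hasDeriv_right_of_le t.coe_nonneg (hc.mono hsub)
      (f' := fun s => exampleField (α s))
      (fun s hs => by
        have hs' : s ∈ Set.Ico (0 : ℝ) T := ⟨hs.1.le, hs.2.trans_le htT⟩
        have h1 := htraj.hasDerivWithinAt s hs'
        simp only [ballCutoff_eq_one (hle s ⟨hs'.1, hs'.2.le⟩), one_smul] at h1
        exact h1.mono Set.Ioi_subset_Ici_self)
      ((hF.comp_continuousOn (hc.mono hsub)).intervalIntegrable_of_Icc t.coe_nonneg)
    rw [hα0] at this
    have e : ∫ s in (0 : ℝ)..t, exampleField (α s.toNNReal) =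
        ∫ s in (0 : ℝ)..t, exampleField (α s) := by
      refine intervalIntegral.integral_congr fun s hs => ?_
      rw [Set.uIcc_of_le t.coe_nonneg] at hs
      simp only [Real.coe_toNNReal s hs.1]
    simp only [e, this]
    abel

end Existence

/-! ### Unbounded transients -/

section BlowUp

theorem IsScaledTrajectory.exists_natCast_sq_lt {α : ℝ → EllTwo}
    (h : IsScaledTrajectory (fun _ => 1) α 0 1) (h0 : α 0 0 = 12) {n : ℕ} (hn : n ≠ 0)
    (h1 : α 0 n = 1) : ∃ t ∈ Set.Icc (0 : ℝ) 1, (n : ℝ) ^ 2 < α t n := by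
  by_contra! hle
  -- This is `12 / e > 4`. Of these 4 units of quadratic growth, `-xₙ|xₙ|` costs one and the cubic
  -- term at most one while `xₙ ≤ n²`.
  have hα0 : ∀ t ∈ Set.Icc (0 : ℝ) 1, 4 ≤ α t 0 := by
    intro t ht
    rw [h.apply_zero_eq ht, h0, sub_zero, Real.exp_neg, inv_mul_eq_div, le_div_iff₀ (Real.exp_pos t)]
    have h2 : Real.exp t ≤ Real.exp 1 := Real.exp_le_exp.2 ht.2
    linarith [Real.exp_one_lt_d9]
  have hrhs : ∀ t ∈ Set.Icc (0 : ℝ) 1, 0 ≤ α t n →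
      -α t n + 2 * α t n ^ 2 ≤ exampleRhs (α t) n := by
    intro t ht hpos
    rw [exampleRhs_of_ne_zero _ hn, abs_of_nonneg hpos]
    have hn' : (0 : ℝ) < (n : ℝ) ^ 2 := by positivity
    have h2 : 1 / (n : ℝ) ^ 2 * α t n ≤ 1 := by
      rw [one_div, inv_mul_eq_div, div_le_one hn']; exact hle t ht
    have h3 := mul_le_mul_of_nonneg_right h2 (sq_nonneg (α t n))
    have h4 := mul_le_mul_of_nonneg_left (hα0 t ht) (sq_nonneg (α t n))
    nlinarith
  have hge : ∀ t ∈ Set.Icc (0 : ℝ) 1, 1 ≤ α t n := by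
    intro t ht
    have := le_of_hasDerivWithinAt_nonpos_between (m := -1) (M := -(1 / 2))
      (g := fun s => -α s n) (by norm_num) (h.continuousOn_apply n).neg
      (fun s hs => (h.hasDerivWithinAt_apply n hs).fun_neg) (by rw [h1])
      (fun s hs h2 h3 => by
        have := hrhs s ⟨hs.1, hs.2.le⟩ (by linarith)
        nlinarith) t ht
    linarith
  -- For `xₙ ≥ 1` the rate is at least `xₙ²`, so `1/xₙ + t` cannot increase from 1; at time 1 this
  -- would force `1/xₙ ≤ 0`.
  have key := le_of_hasDerivWithinAt_nonpos_between (m := 1) (M := 2)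
    (g := fun s => (α s n)⁻¹ + s) one_lt_two
    (((h.continuousOn_apply n).inv₀ fun s hs => by linarith [hge s hs]).add continuousOn_id)
    (fun s hs => ((h.hasDerivWithinAt_apply n hs).fun_inv
      (by linarith [hge s ⟨hs.1, hs.2.le⟩])).fun_add (hasDerivWithinAt_id _ _))
    (by simp [h1])
    (fun s hs _ _ => by
      have h2 := hge s ⟨hs.1, hs.2.le⟩
      have h3 := hrhs s ⟨hs.1, hs.2.le⟩ (by linarith)
      have h4 : 0 < α s n ^ 2 := by positivity
      rw [one_mul, neg_div]
      have : 1 ≤ exampleRhs (α s) n / α s n ^ 2 := by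
        rw [le_div_iff₀ h4]; nlinarith
      linarith) 1 (by simp)
  have h5 : 0 < (α 1 n)⁻¹ := inv_pos.2 (by linarith [hge 1 (by simp)])
  simp only at key
  linarith

end BlowUp

/-! ### Stability properties of the example and failure of BORS -/

section ExampleSystem

theorem isScaledTrajectory_exampleSystem (x : EllTwo) (u : Unit) {a : ℝ} (ha : 0 ≤ a) (b : ℝ) :
    IsScaledTrajectory (fun _ => 1) (fun s => exampleSystem.phi s.toNNReal x u) a b where
  continuousOn := ((continuous_mildSystem_phi lipschitzOnWith_exampleField
    hasArbitrarilyLongMildSolutions_exampleField x u).comp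
      continuous_real_toNNReal).continuousOn
  nonneg _ _ := zero_le_one
  hasDerivWithinAt t ht := by
    rw [one_smul]
    exact hasDerivWithinAt_mildSystem_phi lipschitzOnWith_exampleField
      hasArbitrarilyLongMildSolutions_exampleField x u (ha.trans ht.1)

theorem exampleSystem_phi_zero (x : EllTwo) (u : Unit) : exampleSystem.phi 0 x u = x :=
  mildSystem_phi_zero lipschitzOnWith_exampleField
    hasArbitrarilyLongMildSolutions_exampleField x u

theorem isClassKL_mul_exp :
    IsClassKL (fun r t => r * (Real.exp (-(t : ℝ))).toNNReal) where
  isClassK t :=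
    { map_zero := zero_mul _
      continuous := continuous_id.mul continuous_const
      strictMono := fun _ _ h =>
        mul_lt_mul_of_pos_right h (Real.toNNReal_pos.2 (Real.exp_pos _)) }
  isClassL r _ :=
    { continuous := continuous_const.mul (continuous_real_toNNReal.comp
        (Real.continuous_exp.comp NNReal.continuous_coe.neg))
      antitone := fun s t h => by
        refine mul_le_mul_right (Real.toNNReal_le_toNNReal (Real.exp_le_exp.2 ?_)) _
        exact neg_le_neg (by exact_mod_cast h)
      tendsto_zero := by
        have h1 : Filter.Tendsto (fun t : ℝ≥0 => Real.exp (-(t : ℝ))) Filter.atTop (nhds 0) :=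
          Real.tendsto_exp_neg_atTop_nhds_zero.comp (NNReal.tendsto_coe_atTop.2 Filter.tendsto_id)
        simpa using (((continuous_real_toNNReal.tendsto 0).comp h1).const_mul r) }

theorem zeroKLEstimateOn_exampleSystem {A : Set EllTwo} (hA : ∀ x ∈ A, |x 0| ≤ 1) :
    exampleSystem.ZeroKLEstimateOn A := by
  refine ⟨_, isClassKL_mul_exp, fun x hx t => ?_⟩
  have h := isScaledTrajectory_exampleSystem x 0 le_rfl t
  have h1 := h.norm_le_exp (by simpa [exampleSystem_phi_zero] using hA x hx)
    (Set.right_mem_Icc.2 t.coe_nonneg)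
  simp only [Real.toNNReal_coe, Real.toNNReal_zero, sub_zero, exampleSystem_phi_zero] at h1
  rw [← NNReal.coe_le_coe, NNReal.coe_mul, Real.coe_toNNReal _ (Real.exp_pos _).le, mul_comm]
  exact h1

theorem zeroUAS_exampleSystem : exampleSystem.ZeroUAS :=
  ⟨1, one_pos, zeroKLEstimateOn_exampleSystem fun x hx =>
    (x.abs_apply_le 0).trans (mem_ball_zero_iff.1 hx).le⟩

theorem exp_neg_mul_le {B ε s : ℝ} (hε : 0 < ε) (hs : B / ε ≤ s) : Real.exp (-s) * B ≤ ε := by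
  rw [Real.exp_neg, inv_mul_eq_div, div_le_iff₀ (Real.exp_pos s), mul_comm]
  rw [div_le_iff₀ hε] at hs
  nlinarith [Real.add_one_le_exp s]

theorem zeroUGATT_exampleSystem : exampleSystem.ZeroUGATT := by
  intro ε hε δ hδ
  -- By `exp_neg_mul_le`, this waiting time brings `|x₀|` from `δ` down to `1/2`.
  set T₀ : ℝ := δ / (1 / 2) with hT₀
  have hT₀0 : 0 ≤ T₀ := by positivity
  set B : ℝ := (1 + 16 * δ ^ 2) * δ with hB
  refine ⟨(T₀ + 1 + B / ε).toNNReal, fun x hx t ht => ?_⟩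
  set α : ℝ → EllTwo := fun s => exampleSystem.phi s.toNNReal x 0 with hα
  have hα0 : α 0 = x := by simp [hα, exampleSystem_phi_zero]
  have htraj : ∀ a b : ℝ, 0 ≤ a → IsScaledTrajectory (fun _ => 1) α a b :=
    fun a b ha => isScaledTrajectory_exampleSystem x 0 ha b
  have hx0 : |α 0 0| ≤ δ := by rw [hα0]; exact (x.abs_apply_le 0).trans hx
  have h₁ : |α T₀ 0| ≤ 1 / 2 := by
    rw [(htraj 0 T₀ le_rfl).apply_zero_eq (Set.right_mem_Icc.2 hT₀0), abs_mul,
      abs_of_pos (Real.exp_pos _), sub_zero]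
    exact (mul_le_mul_of_nonneg_left hx0 (Real.exp_pos _).le).trans
      (exp_neg_mul_le (by norm_num) le_rfl)
  have hmem : T₀ + 1 ∈ Set.Icc T₀ (T₀ + 1) := Set.right_mem_Icc.2 (by linarith)
  have hmem' : T₀ + 1 ∈ Set.Icc 0 (T₀ + 1) := Set.right_mem_Icc.2 (by linarith)
  have h₂ : |α (T₀ + 1) 0| ≤ 1 := by
    linarith [(htraj T₀ (T₀ + 1) hT₀0).abs_apply_zero_le hmem]
  have h₃ : ‖α (T₀ + 1)‖ ≤ B := by
    have hC : 1 ≤ 1 + 16 * δ ^ 2 := by nlinarith [sq_nonneg δ]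
    have : ‖α (T₀ + 1)‖ ^ 2 ≤ (1 + 16 * δ ^ 2) * ‖x‖ ^ 2 := by
      refine EllTwo.norm_sq_le_mul fun n => ?_
      rcases le_total (2 * δ * |x n|) 1 with hn | hn
      · have := (htraj 0 (T₀ + 1) le_rfl).sq_apply_le_of_small hδ hx0
          (by rw [hα0]; exact hn) _ hmem'
        rw [hα0] at this
        exact this.trans (le_mul_of_one_le_left (sq_nonneg _) hC)
      · rcases eq_or_ne n 0 with rfl | hn0
        · have := (htraj 0 (T₀ + 1) le_rfl).sq_apply_zero_le _ hmem'
          rw [hα0] at this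
          exact this.trans (le_mul_of_one_le_left (sq_nonneg _) hC)
        -- One unit of time after `T₀`, `xₙ² ≤ 4`; initially large modes satisfy `1 ≤ 4δ²xₙ²`,
        -- whence the constant `16δ²`.
        · have h4 := (htraj T₀ (T₀ + 1) hT₀0).sq_mul_sq_apply_le h₁ hn0 hmem
          rw [add_sub_cancel_left, one_pow, one_mul] at h4
          have h5 := one_le_pow₀ hn (n := 2)
          rw [mul_pow, sq_abs, mul_pow] at h5
          nlinarith [sq_nonneg (x n)]
    refine le_of_sq_le_sq (this.trans ?_) (by positivity)
    rw [hB, mul_pow]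
    have h6 : ‖x‖ ^ 2 ≤ δ ^ 2 := by gcongr
    exact mul_le_mul (le_self_pow₀ hC two_ne_zero) h6 (sq_nonneg _) (by positivity)
  have ht' : T₀ + 1 + B / ε ≤ t := Real.toNNReal_le_iff_le_coe.1 ht
  have hBε : 0 ≤ B / ε := by positivity
  have h₄ := (htraj (T₀ + 1) t (by linarith)).norm_le_exp h₂
    (Set.right_mem_Icc.2 (by linarith))
  have h₅ : ‖α t‖ ≤ ε :=
    (h₄.trans (mul_le_mul_of_nonneg_left h₃ (Real.exp_pos _).le)).trans
      (exp_neg_mul_le hε (by linarith))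
  simpa [hα] using h₅

theorem not_bors_exampleSystem : ¬ exampleSystem.BORS := by
  intro h
  obtain ⟨M, hM⟩ := h 14 (by norm_num) 2
  set n := ⌈M⌉₊ + 1 with hn
  have hn0 : n ≠ 0 := by omega
  -- The norm is at most 13 for every `n`, while the peak exceeds `n² ≥ n ≥ M`.
  set x : EllTwo := lp.single 2 0 12 + lp.single 2 n 1 with hx
  have hx0 : x 0 = 12 := by simp [hx, lp.single_apply, hn0.symm]
  have hxn : x n = 1 := by simp [hx, lp.single_apply, hn0]
  have hnorm : ‖x‖ < 14 := by
    refine (norm_add_le _ _).trans_lt ?_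
    rw [lp.norm_single (by norm_num), lp.norm_single (by norm_num)]
    norm_num
  obtain ⟨t, ht, hlt⟩ := (isScaledTrajectory_exampleSystem x 0 le_rfl 1).exists_natCast_sq_lt
    (by simpa [exampleSystem_phi_zero] using hx0) hn0
    (by simpa [exampleSystem_phi_zero] using hxn)
  have h1 : ‖exampleSystem.phi t.toNNReal x 0‖ ≤ M :=
    hM x 0 t.toNNReal hnorm (by simp) ((Real.toNNReal_lt_iff_lt_coe ht.1).2
      (by push_cast; linarith [ht.2]))
  have h2 := (le_abs_self _).trans ((exampleSystem.phi t.toNNReal x 0).abs_apply_le n)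
  have h3 : M ≤ n := by
    rw [hn]; push_cast; linarith [Nat.le_ceil M]
  have h4 : (n : ℝ) ≤ (n : ℝ) ^ 2 := by exact_mod_cast Nat.le_self_pow two_ne_zero n
  linarith

end ExampleSystem

/-! ### Consequences for OCAG and OUAG -/

namespace OutputSystem

variable {X U 𝒰 Y : Type*}
    [NormedAddCommGroup X] [NormedSpace ℝ X] [AddCommGroup U] [Module ℝ U]
    [NormedAddCommGroup 𝒰] [NormedSpace ℝ 𝒰] [NormedAddCommGroup Y] [NormedSpace ℝ Y]

/-- By monotonicity, `β(C + c, 0) + γ(C)` bounds all outputs, uniformly in time. -/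
theorem OCAG.bors {S : OutputSystem X U 𝒰 Y} (h : S.OCAG) : S.BORS := by
  obtain ⟨β, γ, c, hβ, hγ, h⟩ := h
  intro C hC τ
  refine ⟨(β (C.toNNReal + c) 0 + γ C.toNNReal : ℝ≥0), fun x u t hx hu _ => ?_⟩
  have hx' : ‖x‖₊ ≤ C.toNNReal := NNReal.le_toNNReal_of_coe_le hx.le
  have hu' : ‖u‖₊ ≤ C.toNNReal := NNReal.le_toNNReal_of_coe_le hu.le
  have hCc : 0 < C.toNNReal + c := add_pos_of_pos_of_nonneg (Real.toNNReal_pos.2 hC) zero_le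
  have h1 : β (‖x‖₊ + c) t ≤ β (C.toNNReal + c) t :=
    (hβ.isClassK t).strictMono.monotone (by gcongr)
  have h2 : β (C.toNNReal + c) t ≤ β (C.toNNReal + c) 0 :=
    (hβ.isClassL _ hCc).antitone zero_le
  have h3 : γ ‖u‖₊ ≤ γ C.toNNReal := hγ.isClassK.strictMono.monotone hu'
  exact_mod_cast (h x u t).trans (add_le_add (h1.trans h2) h3)

end OutputSystem

theorem ouag_exampleSystem : exampleSystem.OUAG := by
  refine ⟨id, ⟨⟨rfl, continuous_id, strictMono_id⟩, fun M => ⟨M + 1, by simp⟩⟩,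
    fun ε r s hε hr _ => ?_⟩
  obtain ⟨T, hT⟩ := zeroUGATT_exampleSystem ε hε r hr
  refine ⟨T, fun x u t hx _ ht => ?_⟩
  have h : ‖exampleSystem.phi t x 0‖₊ ≤ ε := hT x hx.le t ht
  exact h.trans le_self_add

theorem mainTheorem12 :
    -- the right-hand side is Lipschitz continuous on bounded balls
    (∀ R : ℝ, ∃ K : ℝ≥0, LipschitzOnWith K exampleField (Metric.closedBall 0 R)) ∧
    -- the trajectories are the unique maximal mild solutions, and they form a control system
    (∀ (x : EllTwo) (u : Unit), IsUniqueMaximalMildSolution exampleField x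
      (exampleSystem.tmax x u) (fun t => exampleSystem.phi t x u)) ∧
    exampleSystem.IsControlSystem ∧
    exampleSystem.ForwardComplete ∧
    exampleSystem.ZeroUGATT ∧
    exampleSystem.ZeroUAS ∧
    -- sets on which the estimate of uniform asymptotic stability holds
    (∀ r : ℝ, r < 1 → exampleSystem.ZeroKLEstimateOn {x : EllTwo | ∀ n : ℕ, |x n| ≤ r}) ∧
    ¬ exampleSystem.BORS ∧
    -- consequence: asymptotic gain without boundedness does not give the complete gain property
    exampleSystem.OUAG ∧
    ¬ exampleSystem.OCAG :=
  have hF := lipschitzOnWith_exampleField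
  have hE := hasArbitrarilyLongMildSolutions_exampleField
  ⟨hF, isUniqueMaximalMildSolution_mildSystem hF hE, isControlSystem_mildSystem hF hE,
    forwardComplete_mildSystem hF hE, zeroUGATT_exampleSystem, zeroUAS_exampleSystem,
    fun _ hr => zeroKLEstimateOn_exampleSystem fun _ hx => (hx 0).trans hr.le,
    not_bors_exampleSystem, ouag_exampleSystem, fun h => not_bors_exampleSystem h.bors⟩
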